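/- An open set $\emptyset\ne V\subset\mathbb R^n$ is a cone if $\lambda x\in V$ and $x+y\in V$ for all $x,y\in V$, $\lambda>0$, and no $x\neq 0$ satisfies both $x\in\overline V$ and $-x\in\overline V$. Let $G(V)$ be the group of $n\times n$ matrices mapping $V$ onto $V$; $V$ is homogeneous if $G(V)$ acts transitively on $V$. Let $V^*=\{x\in\mathbb R^n: x\cdot y>0 \text{ for all } y\in\overline V,\ y\ne 0\}$ be the dual cone. For a cone $W$ put $\phi_W(x)=\int_{W^*}e^{-x\cdot y}\,dy$ for $x\in W$. For $x\in V^*$ let $x^*=-\operatorname{grad}\log\phi_{V^*}(x)$, which is a point of $V^{**}=V$. For $x\in V$ let $\langle 0,x\rangle=\{y\in V: x-y\in V\}$ and let $\Delta_V(x)$ be the Lebesgue measure of $\langle 0,x\rangle$. Theorem 3.7. Let $V\subset\mathbb R^n$ be a homogeneous cone and let $\beta,\delta\in\mathbb R$. Let $k:V^*\times V\to[0,\infty)$, with $k(x,\cdot)$ measurable for every $x\in V^*$, be $V^*\times V$-homogeneous of order $\beta$, i.e. $k((A^{t})^{-1}x,Ay)=|\det A|^{\beta}k(x,y)$ for all $A\in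 G(V)$, $x\in V^*$, $y\in V$. Assume that $$K\Delta_V^\delta(x)=\int_V k(x,y)\Delta_V^\delta(y)\,dy<\infty\qquad\text{for every }x\in V^*.$$ Assume also that $k$ is not degenerate in the following sense: for each $x\in V^*$, if $k(x,y)=0$ for almost every $y\in\langle 0,x^*\rangle$, then $k(x,y)=0$ for almost every $y\in V$ (this holds automatically if $k$ is strictly positive). Then there is a constant $c\in\mathbb R$ such that $$\int_V k(x,y)\,\Delta_V^\delta(y)\,dy=c\int_{\langle 0,x^*\rangle}k(x,y)\,\Delta_V^\delta(y)\,dy\qquad\text{for all }x\in V^*.$$ -/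

import Mathlib

open MeasureTheory

noncomputable section

namespace HomCone

/-- Euclidean space `ℝⁿ` with its standard inner product and Lebesgue measure. -/
abbrev E (n : ℕ) : Type := EuclideanSpace ℝ (Fin n)

/-- Open convex cones: non-empty open subsets of `ℝⁿ`, stable under positive scaling and under
addition, whose closure contains no pair `x, -x` with `x ≠ 0`. -/
structure IsCone {n : ℕ} (V : Set (E n)) : Prop where
  nonempty : V.Nonempty
  isOpen : IsOpen V
  smul_mem : ∀ x ∈ V, ∀ t : ℝ, 0 < t → t • x ∈ V
  add_mem : ∀ x ∈ V, ∀ y ∈ V, x + y ∈ V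
  pointed : ∀ x ∈ closure V, x ≠ 0 → -x ∉ closure V

/-- The (open) dual cone `V*`. -/
def dual {n : ℕ} (V : Set (E n)) : Set (E n) :=
  {x | ∀ y ∈ closure V, y ≠ 0 → 0 < inner ℝ x y}

/-- The automorphism group `G(V)`: all matrices that map `V` onto `V`. -/
def G {n : ℕ} (V : Set (E n)) : Set (Matrix (Fin n) (Fin n) ℝ) :=
  {A | Matrix.toEuclideanLin A '' V = V}

/-- A homogeneous cone: `G(V)` acts transitively on `V`. -/
structure IsHomogeneousCone {n : ℕ} (V : Set (E n)) : Prop extends IsCone V where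
  transitive : ∀ x ∈ V, ∀ y ∈ V, ∃ A ∈ G V, Matrix.toEuclideanLin A x = y

/-- The characteristic function `φ_V(x) = ∫_{V*} e^{-x·y} dy`, for `x ∈ V`. -/
def charFn {n : ℕ} (V : Set (E n)) (x : E n) : ℝ :=
  ∫ y in dual V, Real.exp (-inner ℝ x y)

/-- The `*`-function of the cone `V`: `x* = -grad log φ_V(x)`, for `x ∈ V`. -/
def star {n : ℕ} (V : Set (E n)) (x : E n) : E n :=
  -gradient (fun z => Real.log (charFn V z)) x

/-- The cone interval `⟨a, b⟩ = {x ∈ V : a <_V x <_V b}`, where `u <_V v` means `v - u ∈ V`. -/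
def interval {n : ℕ} (V : Set (E n)) (a b : E n) : Set (E n) :=
  {x | x ∈ V ∧ x - a ∈ V ∧ b - x ∈ V}

/-- `Δ_V(x)`, the Lebesgue measure of the cone interval `⟨0, x⟩` (a bounded set). -/
def Delta {n : ℕ} (V : Set (E n)) (x : E n) : ℝ :=
  (volume (interval V 0 x)).toReal

/-- `k` is `V* × V`-homogeneous of order `β`: `k((Aᵗ)⁻¹ x, A y) = |det A|^β k(x, y)` for all
`A ∈ G(V)`, `x ∈ V*`, `y ∈ V`. -/
def IsDualHomogeneous {n : ℕ} (V : Set (E n)) (β : ℝ) (k : E n → E n → ℝ) : Prop :=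
  ∀ A ∈ G V, ∀ x ∈ dual V, ∀ y ∈ V,
    k (Matrix.toEuclideanLin (A.transpose)⁻¹ x) (Matrix.toEuclideanLin A y) =
      |A.det| ^ β * k x y

end HomCone

end

open MeasureTheory Filter Topology Set
open scoped RealInnerProductSpace

noncomputable section

namespace HomCone

variable {n : ℕ}

/-! ### Dual sets -/

/-! Replace x by (Aᵗ)⁻¹x with A ∈ G(V). Then x* becomes Ax* (`star_dual_equivariant`), so ⟨0, x*⟩
becomes its image under A, and a change of variables multiplies both integrals by the same factor
|det A|^(1+β+δ) (`setIntegral_relatively_invariant`). Their ratio is thus constant on orbits, and it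
remains to see that V* is one orbit.

For this, send z ∈ V* to the barycenter of V for the density e^(-z·y). This map is equivariant,
takes values in V, and is injective by strict log-convexity of the Laplace transform. If A carries
the barycenter of x to that of y, then (Aᵗ)⁻¹x and y have the same barycenter, so they coincide.
Neither V** = V nor x* ∈ V is needed. -/

lemma inner_nonneg_of_mem_dual {W : Set (E n)} {x y : E n} (hx : x ∈ dual W)
    (hy : y ∈ closure W) : 0 ≤ ⟪x, y⟫ := by
  by_cases h : y = 0
  · simp [h]
  · exact (hx y hy h).le

lemma smul_mem_dual {W : Set (E n)} {x : E n} (hx : x ∈ dual W) {t : ℝ} (ht : 0 < t) :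
    t • x ∈ dual W := fun y hy h0 => by
  rw [real_inner_smul_left]
  exact mul_pos ht (hx y hy h0)

/-- A set stable under positive dilations has an open dual. -/
lemma isOpen_dual {W : Set (E n)} (hW : ∀ x ∈ W, ∀ t : ℝ, 0 < t → t • x ∈ W) :
    IsOpen (dual W) := by
  have hcl : ∀ x ∈ closure W, ∀ t : ℝ, 0 < t → t • x ∈ closure W := fun x hx t ht =>
    map_mem_closure (continuous_const_smul t) hx fun y hy => hW y hy t ht
  have hK : IsCompact (closure W ∩ Metric.sphere (0 : E n) 1) :=
    (isCompact_sphere _ _).inter_left isClosed_closure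
  rw [isOpen_iff_mem_nhds]
  intro x hx
  have hbound : ∃ ε > 0, ∀ y ∈ closure W ∩ Metric.sphere (0 : E n) 1, ε ≤ ⟪x, y⟫ := by
    rcases (closure W ∩ Metric.sphere (0 : E n) 1).eq_empty_or_nonempty with he | hne
    · exact ⟨1, one_pos, by simp [he]⟩
    · obtain ⟨y₀, hy₀, hmin⟩ := hK.exists_isMinOn hne
        (f := fun y => ⟪x, y⟫) (by fun_prop)
      refine ⟨⟪x, y₀⟫, hx y₀ hy₀.1 ?_, fun y hy => hmin hy⟩
      rintro rfl
      simpa using hy₀.2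
  obtain ⟨ε, hε, hb⟩ := hbound
  refine mem_of_superset (Metric.ball_mem_nhds x hε) fun z hz y hy h0 => ?_
  have hn : 0 < ‖y‖ := norm_pos_iff.2 h0
  have h1 := hb (‖y‖⁻¹ • y) ⟨hcl y hy _ (inv_pos.2 hn), by simp [norm_smul, hn.ne']⟩
  rw [real_inner_smul_right, inv_mul_eq_div, le_div_iff₀ hn] at h1
  have h2 : ⟪x - z, y⟫ ≤ ‖x - z‖ * ‖y‖ := real_inner_le_norm _ _
  have h3 : ‖x - z‖ < ε := by
    rw [← dist_eq_norm, dist_comm]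
    exact hz
  rw [inner_sub_left] at h2
  nlinarith

/-- On a set paired nonnegatively with an open set `U`, any `z ∈ U` dominates the norm. -/
lemma exists_norm_le_inner {U W : Set (E n)} (hU : IsOpen U)
    (hUW : ∀ x ∈ U, ∀ y ∈ W, 0 ≤ ⟪x, y⟫) {z : E n} (hz : z ∈ U) :
    ∃ ε > 0, ∀ y ∈ W, ε * ‖y‖ ≤ ⟪z, y⟫ := by
  obtain ⟨r, hr, hball⟩ := Metric.isOpen_iff.1 hU z hz
  refine ⟨r / 2, by positivity, fun y hy => ?_⟩
  by_cases h0 : y = 0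
  · simp [h0]
  have hn : 0 < ‖y‖ := norm_pos_iff.2 h0
  -- Moving from z by r/2 in the direction -y stays in the ball; nonnegativity there gives the bound
  -- at z.
  have hmem : z - (r / 2 * ‖y‖⁻¹) • y ∈ U := by
    apply hball
    rw [Metric.mem_ball, dist_eq_norm, sub_sub_cancel_left, norm_neg, norm_smul,
      Real.norm_of_nonneg (by positivity), mul_assoc, inv_mul_cancel₀ hn.ne']
    linarith
  have h1 := hUW _ hmem y hy
  rw [inner_sub_left, real_inner_smul_left, real_inner_self_eq_norm_sq] at h1
  have h2 : r / 2 * ‖y‖⁻¹ * ‖y‖ ^ 2 = r / 2 * ‖y‖ := by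
    field_simp
  linarith

/-- Openness of V upgrades the weak inequality, inherited by closure, to a strict one. This makes
V** nonempty, hence its exponential integral positive. -/
lemma IsCone.subset_dual_dual {V : Set (E n)} (hV : IsCone V) : V ⊆ dual (dual V) := by
  intro x hx y hy h0
  have hnonneg : ∀ v ∈ V, 0 ≤ ⟪v, y⟫ := by
    intro v hv
    refine closure_minimal (s := dual V) (t := {w | 0 ≤ ⟪v, w⟫}) ?_
      (isClosed_le continuous_const (by fun_prop)) hy
    intro w hw
    change 0 ≤ ⟪v, w⟫
    rw [real_inner_comm]
    exact inner_nonneg_of_mem_dual hw (subset_closure hv)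
  obtain ⟨ε, hε, h⟩ := exists_norm_le_inner (W := {y}) hV.isOpen
    (fun v hv w hw => by rw [mem_singleton_iff.1 hw]; exact hnonneg v hv) hx
  exact (mul_pos hε (norm_pos_iff.2 h0)).trans_le (h y rfl)

lemma IsCone.isOpen_dual {V : Set (E n)} (hV : IsCone V) : IsOpen (dual V) :=
  HomCone.isOpen_dual hV.smul_mem

lemma IsCone.convex {V : Set (E n)} (hV : IsCone V) : Convex ℝ V := by
  rw [convex_iff_forall_pos]
  intro x hx y hy a b ha hb _
  exact hV.add_mem _ (hV.smul_mem x hx a ha) _ (hV.smul_mem y hy b hb)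

/-! ### Pairs of contragredient linear maps -/

lemma dual_image {L M : E n ≃L[ℝ] E n} (h : ∀ x y, ⟪M x, L y⟫ = ⟪x, y⟫) (W : Set (E n)) :
    dual (L '' W) = M '' dual W := by
  have hcl : closure (L '' W) = L '' closure W := (L.toHomeomorph.image_closure W).symm
  ext z
  obtain ⟨x, rfl⟩ := M.surjective z
  rw [M.injective.mem_set_image]
  constructor
  · intro hx y hy h0
    rw [← h]
    exact hx (L y) (hcl ▸ mem_image_of_mem L hy) (by simpa using h0)
  · intro hx y hy h0
    rw [hcl] at hy
    obtain ⟨w, hw, rfl⟩ := hy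
    rw [h]
    exact hx w hw (by simpa using h0)

lemma setIntegral_image {F : Type*} [NormedAddCommGroup F] [NormedSpace ℝ F]
    (L : E n ≃L[ℝ] E n) {s : Set (E n)} (hs : MeasurableSet s) (g : E n → F) :
    ∫ y in L '' s, g y =
      |LinearMap.det (L : E n →ₗ[ℝ] E n)| • ∫ y in s, g (L y) := by
  rw [integral_image_eq_integral_abs_det_fderiv_smul volume hs
    (fun x _ => L.hasFDerivAt.hasFDerivWithinAt) L.injective.injOn]
  exact integral_smul _ _

/-- An element of `G(V)` is invertible; together with its contragredient it gives a pair of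
continuous linear equivalences preserving the pairing. -/
lemma exists_contragredient {V : Set (E n)} (hV : IsCone V) {A : Matrix (Fin n) (Fin n) ℝ}
    (hA : A ∈ G V) :
    ∃ L M : E n ≃L[ℝ] E n, (∀ x, L x = Matrix.toEuclideanLin A x) ∧
      (∀ x, M x = Matrix.toEuclideanLin (A.transpose)⁻¹ x) ∧
      (∀ x y, ⟪M x, L y⟫ = ⟪x, y⟫) ∧ LinearMap.det (L : E n →ₗ[ℝ] E n) = A.det := by
  have hdet : LinearMap.det (Matrix.toEuclideanLin A) = A.det := by
    rw [Matrix.toEuclideanLin, Matrix.toLpLin_eq_toLin, LinearMap.det_toLin]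
  -- The range is a subspace containing the nonempty open set V.
  have hrange : LinearMap.range (Matrix.toEuclideanLin A) = ⊤ := by
    apply Submodule.eq_top_of_nonempty_interior' (R := ℝ)
    refine hV.nonempty.mono (interior_maximal ?_ hV.isOpen)
    rw [LinearMap.coe_range]
    conv_lhs => rw [← show _ = V from hA]
    exact image_subset_range _ _
  have hunit : IsUnit A.det := by
    rw [← hdet]
    exact (LinearMap.isUnit_iff_range_eq_top _).2 hrange |>.map LinearMap.det
  have hunitT : IsUnit (A.transpose).det := by rwa [Matrix.det_transpose]
  have hmul : ∀ (P Q : Matrix (Fin n) (Fin n) ℝ), P * Q = 1 → ∀ x,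
      Matrix.toEuclideanLin P (Matrix.toEuclideanLin Q x) = x := by
    intro P Q hPQ x
    rw [← LinearMap.comp_apply, ← Matrix.toLpLin_mul, hPQ, Matrix.toLpLin_one, LinearMap.id_apply]
  let L := (LinearEquiv.ofLinearMap (Matrix.toEuclideanLin A) (Matrix.toEuclideanLin A⁻¹)
    (LinearMap.ext (hmul _ _ (Matrix.mul_nonsing_inv A hunit)))
    (LinearMap.ext (hmul _ _ (Matrix.nonsing_inv_mul A hunit)))).toContinuousLinearEquiv
  let M := (LinearEquiv.ofLinearMap (Matrix.toEuclideanLin (A.transpose)⁻¹)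
    (Matrix.toEuclideanLin A.transpose)
    (LinearMap.ext (hmul _ _ (Matrix.nonsing_inv_mul _ hunitT)))
    (LinearMap.ext (hmul _ _ (Matrix.mul_nonsing_inv _ hunitT)))).toContinuousLinearEquiv
  refine ⟨L, M, fun _ => rfl, fun _ => rfl, fun x y => ?_, hdet⟩
  change ⟪Matrix.toEuclideanLin (A.transpose)⁻¹ x, Matrix.toEuclideanLin A y⟫ = ⟪x, y⟫
  have hadj := Matrix.toEuclideanLin_conjTranspose_eq_adjoint A
  rw [Matrix.conjTranspose_eq_transpose_of_trivial] at hadj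
  rw [← LinearMap.adjoint_inner_left, ← hadj, hmul _ _ (Matrix.mul_nonsing_inv _ hunitT)]

/-! ### Exponential integrals -/

/-- Comparison with (1 + ‖x‖)^(-(n+1)); the extra factor 1 + ‖x‖ covers first moments. -/
lemma integrable_one_add_norm_mul_exp {ε : ℝ} (hε : 0 < ε) :
    Integrable (fun x : E n => (1 + ‖x‖) * Real.exp (-(ε * ‖x‖))) := by
  have hint := integrable_one_add_norm (E := E n) (μ := volume) (r := (n + 1 : ℕ))
    (by simp)
  obtain ⟨C, hC⟩ : ∃ C : ℝ, ∀ t : ℝ, 0 ≤ t →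
      (1 + t) ^ (n + 2) * Real.exp (-(ε * t)) ≤ C := by
    -- From s^(n+2)/(n+2)! ≤ e^s at s = ε(1 + t).
    refine ⟨((n + 2).factorial : ℝ) / ε ^ (n + 2) * Real.exp ε, fun t ht => ?_⟩
    have h := Real.pow_div_factorial_le_exp (x := ε * (1 + t)) (by positivity) (n + 2)
    rw [div_le_iff₀ (by positivity), mul_pow] at h
    have he : Real.exp (ε * (1 + t)) * Real.exp (-(ε * t)) = Real.exp ε := by
      rw [← Real.exp_add]
      ring_nf
    rw [div_mul_eq_mul_div, le_div_iff₀ (by positivity)]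
    calc (1 + t) ^ (n + 2) * Real.exp (-(ε * t)) * ε ^ (n + 2)
        = ε ^ (n + 2) * (1 + t) ^ (n + 2) * Real.exp (-(ε * t)) := by ring
      _ ≤ Real.exp (ε * (1 + t)) * (n + 2).factorial * Real.exp (-(ε * t)) := by gcongr
      _ = (n + 2).factorial * Real.exp ε := by rw [← he]; ring
  refine (hint.const_mul C).mono' (by fun_prop) (Eventually.of_forall fun x => ?_)
  have hx := hC ‖x‖ (norm_nonneg x)
  rw [Real.norm_of_nonneg (by positivity), Real.rpow_neg (by positivity), Real.rpow_natCast,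
    ← div_eq_mul_inv, le_div_iff₀ (by positivity)]
  calc _ = (1 + ‖x‖) ^ (n + 2) * Real.exp (-(ε * ‖x‖)) := by ring
    _ ≤ C := hx

section ExpIntegral

variable {U W : Set (E n)}

lemma integrableOn_exp_neg_inner_smul {F : Type*} [NormedAddCommGroup F] [NormedSpace ℝ F]
    (hU : IsOpen U) (hW : IsOpen W) (hUW : ∀ x ∈ U, ∀ y ∈ W, 0 ≤ ⟪x, y⟫) {z : E n} (hz : z ∈ U)
    {f : E n → F} (hf : Continuous f) (hfb : ∃ C, ∀ y, ‖f y‖ ≤ C * (1 + ‖y‖)) :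
    IntegrableOn (fun y => Real.exp (-⟪z, y⟫) • f y) W := by
  obtain ⟨ε, hε, hb⟩ := exists_norm_le_inner hU hUW hz
  obtain ⟨C, hC⟩ := hfb
  refine ((integrable_one_add_norm_mul_exp (n := n) hε).const_mul C).integrableOn.mono'
    (by fun_prop) ?_
  refine (ae_restrict_iff' hW.measurableSet).2 (Eventually.of_forall fun y hy => ?_)
  rw [norm_smul, Real.norm_of_nonneg (Real.exp_pos _).le, mul_comm, ← mul_assoc]
  have : Real.exp (-⟪z, y⟫) ≤ Real.exp (-(ε * ‖y‖)) := by
    gcongr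
    exact hb y hy
  exact mul_le_mul (hC y) this (Real.exp_pos _).le ((norm_nonneg _).trans (hC y))

lemma integrableOn_exp_neg_inner (hU : IsOpen U) (hW : IsOpen W)
    (hUW : ∀ x ∈ U, ∀ y ∈ W, 0 ≤ ⟪x, y⟫) {z : E n} (hz : z ∈ U) :
    IntegrableOn (fun y => Real.exp (-⟪z, y⟫)) W := by
  simpa using integrableOn_exp_neg_inner_smul hU hW hUW hz (f := fun _ => (1 : ℝ))
    continuous_const ⟨1, fun y => by simp⟩

lemma eq_zero_of_setIntegral_eq_zero (hW : IsOpen W) {f : E n → ℝ} (hf : Continuous f)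
    (hf0 : ∀ y ∈ W, 0 ≤ f y) (hfi : IntegrableOn f W) (h : ∫ y in W, f y = 0) :
    ∀ y ∈ W, f y = 0 := by
  rw [setIntegral_eq_zero_iff_of_nonneg_ae
    ((ae_restrict_iff' hW.measurableSet).2 (Eventually.of_forall hf0)) hfi] at h
  exact Measure.eqOn_open_of_ae_eq h hW hf.continuousOn continuousOn_const

lemma setIntegral_exp_pos (hU : IsOpen U) (hW : IsOpen W) (hne : W.Nonempty)
    (hUW : ∀ x ∈ U, ∀ y ∈ W, 0 ≤ ⟪x, y⟫) {z : E n} (hz : z ∈ U) :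
    0 < ∫ y in W, Real.exp (-⟪z, y⟫) := by
  refine lt_of_le_of_ne (integral_nonneg fun y => (Real.exp_pos _).le) fun h => ?_
  obtain ⟨y, hy⟩ := hne
  exact (Real.exp_pos _).ne' (eq_zero_of_setIntegral_eq_zero hW (by fun_prop)
    (fun y _ => (Real.exp_pos _).le) (integrableOn_exp_neg_inner hU hW hUW hz) h.symm y hy)

/-- The barycenter of `W` for the density `y ↦ exp (-⟪z, y⟫)`. -/
def barycenter (W : Set (E n)) (z : E n) : E n :=
  (∫ y in W, Real.exp (-⟪z, y⟫))⁻¹ • ∫ y in W, Real.exp (-⟪z, y⟫) • y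

lemma setIntegral_exp_mul_inner_sub_barycenter (hU : IsOpen U) (hW : IsOpen W)
    (hne : W.Nonempty) (hUW : ∀ x ∈ U, ∀ y ∈ W, 0 ≤ ⟪x, y⟫) {z : E n} (hz : z ∈ U) (w : E n) :
    ∫ y in W, Real.exp (-⟪z, y⟫) * ⟪w, y - barycenter W z⟫ = 0 := by
  have hZ := setIntegral_exp_pos hU hW hne hUW hz
  have hi₁ := integrableOn_exp_neg_inner hU hW hUW hz
  have hi₂ : IntegrableOn (fun y => Real.exp (-⟪z, y⟫) • y) W :=
    integrableOn_exp_neg_inner_smul hU hW hUW hz continuous_id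
      ⟨1, fun y => by simp⟩
  have hm : ∫ y in W, Real.exp (-⟪z, y⟫) • y =
      (∫ y in W, Real.exp (-⟪z, y⟫)) • barycenter W z := by
    rw [barycenter, smul_inv_smul₀ hZ.ne']
  have hw : ∫ y in W, ⟪w, Real.exp (-⟪z, y⟫) • y⟫ =
      ⟪w, ∫ y in W, Real.exp (-⟪z, y⟫) • y⟫ := integral_inner hi₂ w
  calc ∫ y in W, Real.exp (-⟪z, y⟫) * ⟪w, y - barycenter W z⟫
      = ∫ y in W, (⟪w, Real.exp (-⟪z, y⟫) • y⟫ -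
          Real.exp (-⟪z, y⟫) * ⟪w, barycenter W z⟫) := by
        congr 1 with y
        rw [real_inner_smul_right, inner_sub_right]
        ring
    _ = 0 := by
        rw [integral_sub (hi₂.const_inner w) (hi₁.mul_const _), hw, hm, integral_mul_const,
          real_inner_smul_right, sub_self]

lemma integrableOn_exp_mul_inner_sub (hU : IsOpen U) (hW : IsOpen W)
    (hUW : ∀ x ∈ U, ∀ y ∈ W, 0 ≤ ⟪x, y⟫) {z : E n} (hz : z ∈ U) (w c : E n) :
    IntegrableOn (fun y => Real.exp (-⟪z, y⟫) * ⟪w, y - c⟫) W := by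
  refine integrableOn_exp_neg_inner_smul (f := fun y => ⟪w, y - c⟫) hU hW hUW hz (by fun_prop)
    ⟨‖w‖ * (1 + ‖c‖), fun y => ?_⟩
  calc ‖⟪w, y - c⟫‖ ≤ ‖w‖ * ‖y - c‖ := norm_inner_le_norm _ _
    _ ≤ ‖w‖ * (‖y‖ + ‖c‖) := by gcongr; exact norm_sub_le _ _
    _ ≤ ‖w‖ * ((1 + ‖c‖) * (1 + ‖y‖)) := by
        gcongr
        nlinarith [norm_nonneg y, norm_nonneg c]
    _ = _ := by ring

/-- Otherwise a functional separating the barycenter from W would be strictly positive on W after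
centring, yet have mean zero. -/
lemma barycenter_mem (hU : IsOpen U) (hW : IsOpen W) (hne : W.Nonempty) (hconv : Convex ℝ W)
    (hUW : ∀ x ∈ U, ∀ y ∈ W, 0 ≤ ⟪x, y⟫) {z : E n} (hz : z ∈ U) : barycenter W z ∈ W := by
  by_contra hc
  obtain ⟨f, hf⟩ := geometric_hahn_banach_open_point hconv hW hc
  set w : E n := -(InnerProductSpace.toDual ℝ (E n)).symm f
  have hwf : ∀ y, ⟪w, y⟫ = -f y := fun y => by
    rw [inner_neg_left, InnerProductSpace.toDual_symm_apply]
  have hpos : ∀ y ∈ W, 0 < Real.exp (-⟪z, y⟫) * ⟪w, y - barycenter W z⟫ := fun y hy => by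
    have := hf y hy
    rw [hwf, map_sub]
    exact mul_pos (Real.exp_pos _) (by linarith)
  obtain ⟨y, hy⟩ := hne
  exact (hpos y hy).ne' (eq_zero_of_setIntegral_eq_zero hW (by fun_prop)
    (fun y hy => (hpos y hy).le) (integrableOn_exp_mul_inner_sub hU hW hUW hz _ _)
    (setIntegral_exp_mul_inner_sub_barycenter hU hW ⟨y, hy⟩ hUW hz w) y hy)

/-- Integrate 1 + s ≤ e^s with s = ⟪z - w, y - c⟫ against e^(-⟪z, y⟫): the linear term vanishes
because c is the mean. Equality would force s = 0 throughout the open set W, hence z = w. -/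
lemma exp_inner_mul_setIntegral_lt (hU : IsOpen U) (hW : IsOpen W) (hne : W.Nonempty)
    (hUW : ∀ x ∈ U, ∀ y ∈ W, 0 ≤ ⟪x, y⟫) {z w : E n} (hz : z ∈ U) (hw : w ∈ U) (hzw : z ≠ w) :
    ∫ y in W, Real.exp (-⟪z, y⟫) <
      Real.exp ⟪w - z, barycenter W z⟫ * ∫ y in W, Real.exp (-⟪w, y⟫) := by
  set c := barycenter W z
  have hi₁ := integrableOn_exp_neg_inner hU hW hUW hz
  have hi₂ := (integrableOn_exp_neg_inner hU hW hUW hw).const_mul (Real.exp ⟪w - z, c⟫)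
  have hi₃ := integrableOn_exp_mul_inner_sub hU hW hUW hz (z - w) c
  have hfac : ∀ y, Real.exp ⟪w - z, c⟫ * Real.exp (-⟪w, y⟫) - Real.exp (-⟪z, y⟫) -
      Real.exp (-⟪z, y⟫) * ⟪z - w, y - c⟫ =
      Real.exp (-⟪z, y⟫) * (Real.exp ⟪z - w, y - c⟫ - (⟪z - w, y - c⟫ + 1)) := by
    intro y
    rw [mul_sub, ← Real.exp_add, ← Real.exp_add]
    have : ⟪w - z, c⟫ + -⟪w, y⟫ = -⟪z, y⟫ + ⟪z - w, y - c⟫ := by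
      simp only [inner_sub_left, inner_sub_right]
      ring
    rw [this]
    ring
  have hnonneg : ∀ y, 0 ≤ Real.exp ⟪w - z, c⟫ * Real.exp (-⟪w, y⟫) - Real.exp (-⟪z, y⟫) -
      Real.exp (-⟪z, y⟫) * ⟪z - w, y - c⟫ := fun y => by
    rw [hfac]
    exact mul_nonneg (Real.exp_pos _).le (sub_nonneg.2 (Real.add_one_le_exp _))
  have hval : ∫ y in W, (Real.exp ⟪w - z, c⟫ * Real.exp (-⟪w, y⟫) - Real.exp (-⟪z, y⟫) -
      Real.exp (-⟪z, y⟫) * ⟪z - w, y - c⟫) =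
      (Real.exp ⟪w - z, c⟫ * ∫ y in W, Real.exp (-⟪w, y⟫)) -
        ∫ y in W, Real.exp (-⟪z, y⟫) := by
    have h₁ := integral_sub (hi₂.sub hi₁) hi₃
    simp only [Pi.sub_apply] at h₁
    rw [h₁, integral_sub hi₂ hi₁, integral_const_mul,
      setIntegral_exp_mul_inner_sub_barycenter hU hW hne hUW hz, sub_zero]
  rw [← sub_pos, ← hval]
  refine lt_of_le_of_ne (integral_nonneg hnonneg) fun h => hzw ?_
  have hzero := eq_zero_of_setIntegral_eq_zero hW (by fun_prop) (fun y _ => hnonneg y)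
    ((hi₂.sub hi₁).sub hi₃) h.symm
  have horth : ∀ y ∈ W, ⟪z - w, y - c⟫ = 0 := fun y hy => by
    by_contra hne0
    have := hzero y hy
    rw [hfac] at this
    exact (mul_pos (Real.exp_pos _) (sub_pos.2 (Real.add_one_lt_exp hne0))).ne' this
  obtain ⟨y, hy⟩ := hne
  have hev : ∀ᶠ t : ℝ in 𝓝[>] 0, y + t • (z - w) ∈ W := by
    refine (ContinuousAt.tendsto (f := fun t : ℝ => y + t • (z - w)) (x := 0)
      (by fun_prop)).mono_left nhdsWithin_le_nhds |>.eventually (hW.mem_nhds (by simpa using hy))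
  obtain ⟨t, ht, ht0⟩ := (hev.and self_mem_nhdsWithin).exists
  have h1 := horth _ ht
  have h2 := horth y hy
  rw [add_sub_right_comm, inner_add_right, h2, zero_add, real_inner_smul_right] at h1
  exact sub_eq_zero.1 (inner_self_eq_zero.1 ((mul_eq_zero.1 h1).resolve_left (ne_of_gt ht0)))

/-- Strict log-convexity of the Laplace transform makes the barycenter map injective. -/
lemma barycenter_injOn (hU : IsOpen U) (hW : IsOpen W) (hne : W.Nonempty)
    (hUW : ∀ x ∈ U, ∀ y ∈ W, 0 ≤ ⟪x, y⟫) : InjOn (barycenter W) U := by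
  intro z hz w hw h
  by_contra hzw
  have h1 := exp_inner_mul_setIntegral_lt hU hW hne hUW hz hw hzw
  have h2 := exp_inner_mul_setIntegral_lt hU hW hne hUW hw hz (Ne.symm hzw)
  rw [← h, ← neg_sub w z, inner_neg_left] at h2
  -- With a common barycenter the two exponential factors are inverse, so the strict inequalities
  -- contradict each other.
  have h3 := mul_lt_mul_of_pos_left h2 (Real.exp_pos ⟪w - z, barycenter W z⟫)
  rw [← mul_assoc, ← Real.exp_add, add_neg_cancel, Real.exp_zero, one_mul] at h3
  exact lt_asymm h1 h3

end ExpIntegral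

lemma barycenter_equivariant {W : Set (E n)} (hW : IsOpen W) {L M : E n ≃L[ℝ] E n}
    (h : ∀ x y, ⟪M x, L y⟫ = ⟪x, y⟫) (hL : L '' W = W) (z : E n) :
    barycenter W (M z) = L (barycenter W z) := by
  have hd : |LinearMap.det (L : E n →ₗ[ℝ] E n)| ≠ 0 :=
    abs_ne_zero.2 (LinearEquiv.isUnit_det' L.toLinearEquiv).ne_zero
  have h1 := setIntegral_image L hW.measurableSet (fun y => Real.exp (-⟪M z, y⟫))
  have h2 := setIntegral_image L hW.measurableSet (fun y => Real.exp (-⟪M z, y⟫) • y)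
  simp only [hL, h] at h1 h2
  simp_rw [← map_smul] at h2
  rw [L.integral_comp_comm] at h2
  rw [barycenter, barycenter, h1, h2, map_smul, smul_eq_mul, mul_inv, smul_smul, mul_right_comm,
    inv_mul_cancel₀ hd, one_mul]

/-! ### Behaviour under the automorphism group -/

/-- The automorphism group acts transitively on the dual of a homogeneous cone. -/
lemma IsHomogeneousCone.transitive_dual {V : Set (E n)} (hV : IsHomogeneousCone V) {x y : E n}
    (hx : x ∈ dual V) (hy : y ∈ dual V) :
    ∃ A ∈ G V, Matrix.toEuclideanLin (A.transpose)⁻¹ x = y := by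
  have hc := hV.toIsCone
  have hpair : ∀ u ∈ dual V, ∀ v ∈ V, 0 ≤ ⟪u, v⟫ := fun u hu v hv =>
    inner_nonneg_of_mem_dual hu (subset_closure hv)
  have hmem : ∀ {u}, u ∈ dual V → barycenter V u ∈ V := fun hu =>
    barycenter_mem hc.isOpen_dual hc.isOpen hc.nonempty hc.convex hpair hu
  obtain ⟨A, hA, hAxy⟩ := hV.transitive _ (hmem hx) _ (hmem hy)
  obtain ⟨L, M, hL, hM, h, -⟩ := exists_contragredient hc hA
  have hLV : L '' V = V := by
    rw [image_congr fun a _ => hL a]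
    exact hA
  refine ⟨A, hA, ?_⟩
  rw [← hM]
  refine barycenter_injOn hc.isOpen_dual hc.isOpen hc.nonempty hpair ?_ hy ?_
  · rw [← hLV, dual_image h]
    exact mem_image_of_mem M hx
  · rw [barycenter_equivariant hc.isOpen h hLV, hL, hAxy]

/-- On V*, precomposing log φ with M only adds log |det L|; by the chain rule the gradient then
transforms by L, the contragredient of M. -/
lemma star_dual_equivariant {V : Set (E n)} (hV : IsCone V) {L M : E n ≃L[ℝ] E n}
    (h : ∀ x y, ⟪M x, L y⟫ = ⟪x, y⟫) (hL : L '' V = V) {x : E n} (hx : x ∈ dual V) :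
    star (dual V) (M x) = L (star (dual V) x) := by
  have hd : |LinearMap.det (L : E n →ₗ[ℝ] E n)| ≠ 0 :=
    abs_ne_zero.2 (LinearEquiv.isUnit_det' L.toLinearEquiv).ne_zero
  have hM : M '' dual V = dual V := by rw [← dual_image h, hL]
  have hLL : L '' dual (dual V) = dual (dual V) := by
    rw [← dual_image (L := M) (M := L) (fun a b => by
      rw [real_inner_comm, h, real_inner_comm]), hM]
  have hopen : IsOpen (dual (dual V)) := isOpen_dual fun v hv t ht => smul_mem_dual hv ht
  have hscale : ∀ z, charFn (dual V) (M z) =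
      |LinearMap.det (L : E n →ₗ[ℝ] E n)| * charFn (dual V) z := fun z => by
    have := setIntegral_image L hopen.measurableSet (fun y => Real.exp (-⟪M z, y⟫))
    simp only [hLL, h, smul_eq_mul] at this
    exact this
  have hpos : ∀ z ∈ dual V, 0 < charFn (dual V) z := fun z hz =>
    setIntegral_exp_pos hV.isOpen_dual hopen (hV.nonempty.mono hV.subset_dual_dual)
      (fun u hu v hv => by
        rw [real_inner_comm]
        exact inner_nonneg_of_mem_dual hv (subset_closure hu)) hz
  set g : E n → ℝ := fun z => Real.log (charFn (dual V) z) with hg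
  have hev : g ∘ M =ᶠ[𝓝 x] fun z =>
      Real.log |LinearMap.det (L : E n →ₗ[ℝ] E n)| + g z := by
    filter_upwards [hV.isOpen_dual.mem_nhds hx] with z hz
    simp only [hg, Function.comp_apply, hscale, Real.log_mul hd (hpos z hz).ne']
  have hfd : (fderiv ℝ g (M x)).comp (M : E n →L[ℝ] E n) = fderiv ℝ g x := by
    rw [← M.comp_right_fderiv, hev.fderiv_eq, fderiv_const_add]
  have hgrad : gradient g (M x) = L (gradient g x) := by
    refine ext_inner_right ℝ fun v => ?_
    obtain ⟨u, rfl⟩ := M.surjective v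
    have h1 : ⟪gradient g (M x), M u⟫ = fderiv ℝ g (M x) (M u) :=
      InnerProductSpace.toDual_symm_apply
    have h2 : ⟪gradient g x, u⟫ = fderiv ℝ g x u := InnerProductSpace.toDual_symm_apply
    rw [h1, real_inner_comm, h, real_inner_comm, h2, ← hfd]
    rfl
  simp only [star]
  rw [hgrad, map_neg]

/-! ### Cone intervals, their volumes, and relative invariance -/

lemma interval_zero_image {V : Set (E n)} {L : E n ≃L[ℝ] E n} (hL : L '' V = V) (x : E n) :
    interval V 0 (L x) = L '' interval V 0 x := by
  have hmem : ∀ v, L v ∈ V ↔ v ∈ V := fun v => by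
    conv_lhs => rw [← hL]
    exact L.injective.mem_set_image
  ext z
  obtain ⟨y, rfl⟩ := L.surjective z
  rw [L.injective.mem_set_image]
  simp only [interval, mem_ofPred_eq, sub_zero, ← map_sub, hmem]

lemma Delta_image {V : Set (E n)} {L : E n ≃L[ℝ] E n} (hL : L '' V = V) (x : E n) :
    Delta V (L x) = |LinearMap.det (L : E n →ₗ[ℝ] E n)| * Delta V x := by
  rw [Delta, Delta, interval_zero_image hL]
  have : volume (L '' interval V 0 x) = _ :=
    Measure.addHaar_image_linearMap volume (L : E n →ₗ[ℝ] E n) (interval V 0 x)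
  rw [this, ENNReal.toReal_mul, ENNReal.toReal_ofReal (abs_nonneg _)]

lemma Delta_nonneg (V : Set (E n)) (x : E n) : 0 ≤ Delta V x := ENNReal.toReal_nonneg

lemma IsCone.isOpen_interval {V : Set (E n)} (hV : IsCone V) (a b : E n) :
    IsOpen (interval V a b) :=
  hV.isOpen.inter ((hV.isOpen.preimage (by fun_prop : Continuous fun x : E n => x - a)).inter
    (hV.isOpen.preimage (by fun_prop : Continuous fun x : E n => b - x)))

/-- A point of V* bounds the interval, so its volume is finite and `toReal` does not collapse it to
0. -/
lemma IsCone.Delta_pos {V : Set (E n)} (hV : IsCone V) (hne : (dual V).Nonempty) {x : E n}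
    (hx : x ∈ V) : 0 < Delta V x := by
  obtain ⟨z, hz⟩ := hne
  have hpair : ∀ u ∈ dual V, ∀ v ∈ V, 0 ≤ ⟪u, v⟫ := fun u hu v hv =>
    inner_nonneg_of_mem_dual hu (subset_closure hv)
  obtain ⟨ε, hε, hb⟩ := exists_norm_le_inner hV.isOpen_dual hpair hz
  have hbdd : interval V 0 x ⊆ Metric.closedBall 0 (⟪z, x⟫ / ε) := fun y hy => by
    rw [mem_closedBall_zero_iff, le_div_iff₀ hε, mul_comm]
    have h1 := hpair z hz _ hy.2.2
    rw [inner_sub_right] at h1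
    linarith [hb y hy.1]
  have hhalf : (1 / 2 : ℝ) • x ∈ interval V 0 x := by
    have h1 : (1 / 2 : ℝ) • x ∈ V := hV.smul_mem x hx _ (by norm_num)
    refine ⟨h1, by simpa using h1, ?_⟩
    have : x - (1 / 2 : ℝ) • x = (1 / 2 : ℝ) • x := by module
    rwa [this]
  exact ENNReal.toReal_pos ((hV.isOpen_interval 0 x).measure_pos volume ⟨_, hhalf⟩).ne'
    ((measure_mono hbdd).trans_lt measure_closedBall_lt_top).ne

/-- Relative invariance of the integrals `∫ k(x, y) Δ(y)^δ dy` over subsets of the cone. -/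
lemma setIntegral_relatively_invariant {V : Set (E n)} {β δ : ℝ} {k : E n → E n → ℝ}
    (hkβ : IsDualHomogeneous V β k) {A : Matrix (Fin n) (Fin n) ℝ} (hA : A ∈ G V)
    {L : E n ≃L[ℝ] E n} (hLA : ∀ x, L x = Matrix.toEuclideanLin A x)
    (hdet : LinearMap.det (L : E n →ₗ[ℝ] E n) = A.det) {s : Set (E n)} (hs : MeasurableSet s)
    (hsV : s ⊆ V) {x : E n} (hx : x ∈ dual V) :
    ∫ y in L '' s, k (Matrix.toEuclideanLin (A.transpose)⁻¹ x) y * Delta V y ^ δ =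
      (|A.det| * (|A.det| ^ β * |A.det| ^ δ)) * ∫ y in s, k x y * Delta V y ^ δ := by
  have hLV : L '' V = V := by
    rw [image_congr fun a _ => hLA a]
    exact hA
  rw [setIntegral_image L hs, hdet, smul_eq_mul, mul_assoc,
    ← integral_const_mul (|A.det| ^ β * |A.det| ^ δ)]
  refine congrArg _ (setIntegral_congr_fun hs fun y hy => ?_)
  rw [Delta_image hLV, hdet, Real.mul_rpow (abs_nonneg _) (Delta_nonneg V y), hLA,
    hkβ A hA x hx y (hsV hy)]
  ring

end HomCone

end

theorem theorem3p7 {n : ℕ} (V : Set (HomCone.E n)) (hV : HomCone.IsHomogeneousCone V)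
    (β δ : ℝ) (k : HomCone.E n → HomCone.E n → ℝ)
    (hk0 : ∀ x ∈ HomCone.dual V, ∀ y ∈ V, 0 ≤ k x y)
    (hkβ : HomCone.IsDualHomogeneous V β k)
    (hfin : ∀ x ∈ HomCone.dual V,
      IntegrableOn (fun y => k x y * HomCone.Delta V y ^ δ) V volume)
    (hnd : ∀ x ∈ HomCone.dual V,
      (∀ᵐ y ∂(volume.restrict (HomCone.interval V 0 (HomCone.star (HomCone.dual V) x))),
        k x y = 0) →
      ∀ᵐ y ∂(volume.restrict V), k x y = 0) :
    ∃ c : ℝ, ∀ x ∈ HomCone.dual V,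
      ∫ y in V, k x y * HomCone.Delta V y ^ δ =
        c * ∫ y in HomCone.interval V 0 (HomCone.star (HomCone.dual V) x),
          k x y * HomCone.Delta V y ^ δ := by
  have hc := hV.toIsCone
  rcases (HomCone.dual V).eq_empty_or_nonempty with he | hne
  · exact ⟨0, by simp [he]⟩
  have hsub : ∀ p, HomCone.interval V 0 p ⊆ V := fun p y hy => hy.1
  -- Nondegeneracy enters here: as Δ^δ > 0 on V, a vanishing integral over the interval forces k(x,
  -- ·) = 0 almost everywhere there, hence on V.
  have hzero : ∀ x ∈ HomCone.dual V,
      ∫ y in HomCone.interval V 0 (HomCone.star (HomCone.dual V) x),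
        k x y * HomCone.Delta V y ^ δ = 0 → ∫ y in V, k x y * HomCone.Delta V y ^ δ = 0 := by
    intro x hx h
    set I := HomCone.interval V 0 (HomCone.star (HomCone.dual V) x)
    have hI : MeasurableSet I := (hc.isOpen_interval _ _).measurableSet
    rw [setIntegral_eq_zero_iff_of_nonneg_ae
      (f := fun y => k x y * HomCone.Delta V y ^ δ) ((ae_restrict_iff' hI).2 (.of_forall fun y hy =>
      mul_nonneg (hk0 x hx y (hsub _ hy)) (Real.rpow_nonneg (HomCone.Delta_nonneg V y) _)))
      ((hfin x hx).mono_set (hsub _))] at h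
    have hk : ∀ᵐ y ∂(volume.restrict V), k x y = 0 := by
      refine hnd x hx ?_
      filter_upwards [h, ae_restrict_mem hI] with y hy hyI
      exact (mul_eq_zero.1 hy).resolve_right
        (Real.rpow_pos_of_pos (hc.Delta_pos hne (hsub _ hyI)) δ).ne'
    refine integral_eq_zero_of_ae ?_
    filter_upwards [hk] with y hy
    simp [hy]
  obtain ⟨x₀, hx₀⟩ := hne
  -- The ratio at a base point. If the denominator is 0, so is the numerator by `hzero`, and the
  -- default value c = 0 works.
  refine ⟨(∫ y in V, k x₀ y * HomCone.Delta V y ^ δ) /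
    ∫ y in HomCone.interval V 0 (HomCone.star (HomCone.dual V) x₀),
      k x₀ y * HomCone.Delta V y ^ δ, fun x hx => ?_⟩
  obtain ⟨A, hA, rfl⟩ := hV.transitive_dual hx₀ hx
  obtain ⟨L, M, hLA, hMA, h, hdet⟩ := HomCone.exists_contragredient hc hA
  have hLV : L '' V = V := by
    rw [Set.image_congr fun a _ => hLA a]
    exact hA
  have h₁ := HomCone.setIntegral_relatively_invariant (δ := δ) hkβ hA hLA hdet
    hc.isOpen.measurableSet subset_rfl hx₀
  have h₂ := HomCone.setIntegral_relatively_invariant (δ := δ) hkβ hA hLA hdet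
    (hc.isOpen_interval 0 (HomCone.star (HomCone.dual V) x₀)).measurableSet (hsub _) hx₀
  rw [hLV] at h₁
  rw [← HomCone.interval_zero_image hLV, ← HomCone.star_dual_equivariant hc h hLV hx₀, hMA] at h₂
  rw [h₁, h₂, mul_left_comm (_ / _), div_mul_cancel_of_imp (hzero x₀ hx₀)]
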